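/- Let $p$ be a prime, let $d_x,d_y\ge 0$ be integers, and let $X,Y:\mathbb F_p^3\to\mathbb F_p$ be functions such that * for all $b,c\in\mathbb F_p$, the function $x\mapsto X(x,b,c)$ on $\mathbb F_p$ has degree at most $d_x$; * for all $a,c\in\mathbb F_p$, the function $y\mapsto Y(a,y,ay+c)$ on $\mathbb F_p$ has degree at most $d_y$. Here a function $\mathbb F_p\to\mathbb F_p$ has degree at most $d$ if it is given by a univariate polynomial over $\mathbb F_p$ of degree at most $d$. Let $C_{d_x,d_y}$ be the set of all functions $f:\mathbb F_p^3\to\mathbb F_p$ such that, for all $a,b,c\in\mathbb F_p$, the function $x\mapsto f(x,b,c)$ has degree at most $d_x$ and the function $y\mapsto f(a,y,ay+c)$ has degree at most $d_y$. Let $\delta\in\mathbb R$ be defined by $$\Pr_{(x,y,z)\in\mathbb F_p^3}\big[X(x,y,z)\neq Y(x,y,z)\big]=\delta^3,$$ and suppose that $p\ge 2(d_x+d_y)+5\delta p$. Then there exists $Q\in C_{d_x,d_y}$ such that $$\Pr_{(b,c)\in\mathbb F_p^2}\big[X(\cdot,b,c)\neq Q(\cdot,b,c)\big]+\Pr_{(a,c)\in\mathbb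 F_p^2}\big[y\mapsto Y(a,y,ay+c)\ \text{differs from}\ y\mapsto Q(a,y,ay+c)\big]\le 4\delta .$$ All probabilities are with respect to the uniform distribution, and in the last display functions on a line are counted as different if they differ in at least one point of the line. -/

import Mathlib

open scoped Classical in
/-- The probability of the event `E` under the uniform distribution on a finite set `Ω`. -/
noncomputable def uniformProb {Ω : Type*} [Fintype Ω] (E : Ω → Prop) : ℝ :=
  ((Finset.univ.filter E).card : ℝ) / (Fintype.card Ω : ℝ)

/-- A univariate function on a field has degree at most `d` if it is the evaluation map of some
polynomial of degree at most `d`. -/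
def FunDegreeLE {F : Type*} [Field F] (f : F → F) (d : ℕ) : Prop :=
  ∃ P : Polynomial F, P.natDegree ≤ d ∧ ∀ t : F, f t = P.eval t

/-- The restriction `x ↦ f (x, b, c)` of `f` to the `x`-line with parameters `b, c`. -/
def xLine {F : Type*} (f : F × F × F → F) (b c : F) : F → F :=
  fun x => f (x, b, c)

/-- The restriction `y ↦ f (a, y, a * y + c)` of `f` to the skew line with parameters `a, c`. -/
def skewLine {F : Type*} [Field F] (f : F × F × F → F) (a c : F) : F → F :=
  fun y => f (a, y, a * y + c)

/-- The local code `C_{d_x, d_y}`: functions on `F³` of degree at most `dx` on every `x`-line and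
of degree at most `dy` on every skew line. -/
def localCode (F : Type*) [Field F] (dx dy : ℕ) : Set (F × F × F → F) :=
  {f | (∀ b c : F, FunDegreeLE (xLine f b c) dx) ∧ (∀ a c : F, FunDegreeLE (skewLine f a c) dy)}

/-! The proof is a decoding argument with an error locator, in the manner of Berlekamp–Welch and
Polishchuk–Spielman. The bidegree of `Φ` is the pair of `x`-degrees of `Φ` and `swap Φ`; it bounds
the degree on `x`-lines and on skew lines. There are `(d + 1) ^ 3` independent polynomials of
bidegree at most `(d, d)`. With `d = ⌊δ p⌋` this exceeds the number `(δ p) ^ 3` of points where `X ≠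
Y`, so some nonzero `E` of that bidegree vanishes at all of them (`Tri.exists_ne_zero_vanishing`).

Now `E X = E Y` as functions, so this product has low degree on `x`-lines because of `X`, and on
skew lines because of `Y`. By `Tri.exists_of_mem_localCode` it is a polynomial `P` of low bidegree.
On every line `E` divides `P`, and `Tri.dvd_of_line_dvd` makes this global: if the part of `E`
coprime to `P` were not constant, the resultant with respect to `x`, restricted to a suitable plane
`z = α y + β`, would be a nonzero polynomial in `y` with more roots than its degree allows.

The quotient `Q = P / E` agrees with `X`, respectively `Y`, on every line where `E` is not
identically zero. The leading coefficient of `E` in `x` has total degree at most `2 d` in `y, z`, so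
each family has at most `2 d p` exceptional lines, a fraction of at most `2 δ`. -/

open Polynomial

/-- Polynomials in `x, y, z` over `F`, as polynomials in `x` over `F[y][z]`. -/
abbrev Tri (F : Type*) [Field F] := Polynomial (Polynomial (Polynomial F))

/-! ### Trivariate polynomials, weights and bidegree. -/

namespace Tri

set_option maxSynthPendingDepth 10

section Basic

variable {F : Type*} [Field F]

/-- The variable `x`. -/
noncomputable def x : Tri F := X

/-- The variable `y`. -/
noncomputable def y : Tri F := C (C X)

/-- The variable `z`. -/
noncomputable def z : Tri F := C X

/-- The substitution `x ↦ u`, `y ↦ v`, `z ↦ w`. -/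
noncomputable def subst {B : Type*} [CommRing B] [Algebra F B] (u v w : B) : Tri F →ₐ[F] B :=
  eval₂AlgHom (eval₂AlgHom (aeval v) w fun _ => Commute.all _ _) u fun _ => Commute.all _ _

section subst

variable {B : Type*} [CommRing B] [Algebra F B] (u v w : B)

@[simp] lemma subst_x : subst u v w (x : Tri F) = u := by simp [subst, x]

@[simp] lemma subst_y : subst u v w (y : Tri F) = v := by simp [subst, y]

@[simp] lemma subst_z : subst u v w (z : Tri F) = w := by simp [subst, z]

lemma subst_eq_sum (Φ : Tri F) : subst u v w Φ =
    ∑ i ∈ Φ.support, (∑ k ∈ (Φ.coeff i).support,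
      (∑ j ∈ ((Φ.coeff i).coeff k).support,
        algebraMap F B (((Φ.coeff i).coeff k).coeff j) * v ^ j) * w ^ k) * u ^ i := by
  simp only [subst, eval₂AlgHom_apply, eval₂_eq_sum, Polynomial.sum, RingHom.coe_coe, aeval_def]

variable {u v w} in
lemma algHom_ext {f g : Tri F →ₐ[F] B} (hx : f x = g x) (hy : f y = g y) (hz : f z = g z) :
    f = g := by
  refine Polynomial.algHom_ext' (Polynomial.algHom_ext' (Polynomial.algHom_ext ?_) ?_) ?_
  · exact hy
  · exact hz
  · exact hx

lemma map_subst {B' : Type*} [CommRing B'] [Algebra F B'] (f : B →ₐ[F] B') (Φ : Tri F) :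
    f (subst u v w Φ) = subst (f u) (f v) (f w) Φ := by
  have : f.comp (subst u v w) = subst (f u) (f v) (f w) := algHom_ext (by simp) (by simp) (by simp)
  exact DFunLike.congr_fun this Φ

@[simp] lemma subst_id (Φ : Tri F) : subst (x : Tri F) y z Φ = Φ := by
  have : subst (x : Tri F) y z = AlgHom.id F _ := algHom_ext (by simp) (by simp) (by simp)
  exact DFunLike.congr_fun this Φ

end subst

/-- All monomials of `Φ` have weight at most `N`, where `x, y, z` have weights `a, b, c`. -/
def WeightLE (a b c N : ℤ) (Φ : Tri F) : Prop :=
  ∀ i j k : ℕ, ((Φ.coeff i).coeff k).coeff j ≠ 0 → a * i + b * j + c * k ≤ N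

namespace WeightLE

variable {a b c N M : ℤ} {Φ Ψ : Tri F}

lemma mono (h : WeightLE a b c N Φ) (hNM : N ≤ M) : WeightLE a b c M Φ :=
  fun i j k hne => (h i j k hne).trans hNM

lemma zero : WeightLE a b c N (0 : Tri F) := fun i j k h => by simp at h

lemma add (h : WeightLE a b c N Φ) (h' : WeightLE a b c N Ψ) : WeightLE a b c N (Φ + Ψ) := by
  intro i j k hne
  simp only [coeff_add] at hne
  by_cases h0 : ((Φ.coeff i).coeff k).coeff j = 0
  · exact h' i j k (by simpa [h0] using hne)
  · exact h i j k h0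

lemma neg (h : WeightLE a b c N Φ) : WeightLE a b c N (-Φ) := by
  intro i j k hne
  exact h i j k (by simpa using hne)

lemma sub (h : WeightLE a b c N Φ) (h' : WeightLE a b c N Ψ) : WeightLE a b c N (Φ - Ψ) := by
  rw [sub_eq_add_neg]; exact h.add h'.neg

lemma sum {ι : Type*} {s : Finset ι} {f : ι → Tri F} (h : ∀ i ∈ s, WeightLE a b c N (f i)) :
    WeightLE a b c N (∑ i ∈ s, f i) := by
  classical
  induction s using Finset.induction_on with
  | empty => simpa using zero
  | insert i s hi ih =>
    rw [Finset.sum_insert hi]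
    exact (h i (by simp)).add (ih fun j hj => h j (by simp [hj]))

lemma mul (h : WeightLE a b c N Φ) (h' : WeightLE a b c M Ψ) :
    WeightLE a b c (N + M) (Φ * Ψ) := by
  intro i j k hne
  simp only [coeff_mul, finsetSum_coeff] at hne
  obtain ⟨⟨i₁, i₂⟩, hi, hne⟩ := Finset.exists_ne_zero_of_sum_ne_zero hne
  obtain ⟨⟨k₁, k₂⟩, hk, hne⟩ := Finset.exists_ne_zero_of_sum_ne_zero hne
  obtain ⟨⟨j₁, j₂⟩, hj, hne⟩ := Finset.exists_ne_zero_of_sum_ne_zero hne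
  have h1 := h i₁ j₁ k₁ (left_ne_zero_of_mul hne)
  have h2 := h' i₂ j₂ k₂ (right_ne_zero_of_mul hne)
  obtain rfl := Finset.HasAntidiagonal.mem_antidiagonal.1 hi
  obtain rfl := Finset.HasAntidiagonal.mem_antidiagonal.1 hj
  obtain rfl := Finset.HasAntidiagonal.mem_antidiagonal.1 hk
  push_cast
  linarith

lemma ofField (r : F) : WeightLE a b c 0 (algebraMap F (Tri F) r) := by
  intro i j k hne
  rw [show (algebraMap F (Tri F) r) = C (C (C r)) from rfl] at hne
  simp only [coeff_C] at hne
  split_ifs at hne with h1 <;> simp_all [coeff_C]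
  split_ifs at hne with h2 <;> simp_all [coeff_C]

lemma one : WeightLE a b c 0 (1 : Tri F) := by
  simpa using ofField (a := a) (b := b) (c := c) (1 : F)

lemma pow (h : WeightLE a b c N Φ) (n : ℕ) : WeightLE a b c (n * N) (Φ ^ n) := by
  induction n with
  | zero => simpa using one
  | succ n ih =>
    rw [pow_succ]
    exact (ih.mul h).mono (by push_cast; linarith)

lemma x (h : a ≤ N) : WeightLE a b c N (Tri.x : Tri F) := by
  intro i j k hne
  simp only [Tri.x, coeff_X] at hne
  split_ifs at hne with h1
  · simp only [coeff_one] at hne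
    split_ifs at hne with h2
    · simp only [coeff_one] at hne
      split_ifs at hne with h3
      · subst h1 h2 h3; simpa using h
      · simp at hne
    · simp at hne
  · simp at hne

lemma y (h : b ≤ N) : WeightLE a b c N (Tri.y : Tri F) := by
  intro i j k hne
  simp only [Tri.y, coeff_C] at hne
  split_ifs at hne with h1
  · simp only [coeff_C] at hne
    split_ifs at hne with h2
    · simp only [coeff_X] at hne
      split_ifs at hne with h3
      · subst h1 h2 h3; simpa using h
      · simp at hne
    · simp at hne
  · simp at hne

lemma z (h : c ≤ N) : WeightLE a b c N (Tri.z : Tri F) := by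
  intro i j k hne
  simp only [Tri.z, coeff_C] at hne
  split_ifs at hne with h1
  · simp only [coeff_X] at hne
    split_ifs at hne with h2
    · simp only [coeff_one] at hne
      split_ifs at hne with h3
      · subst h1 h2 h3; simpa using h
      · simp at hne
    · simp at hne
  · simp at hne

lemma const (r : F) (h : 0 ≤ N) : WeightLE a b c N (algebraMap F (Tri F) r) :=
  (ofField r).mono h

lemma subst {u v w : Tri F} {a' b' c' : ℤ} (h : WeightLE a' b' c' N Φ)
    (hu : WeightLE a b c a' u) (hv : WeightLE a b c b' v) (hw : WeightLE a b c c' w) :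
    WeightLE a b c N (subst u v w Φ) := by
  rw [subst_eq_sum]
  refine sum fun i _ => ?_
  rw [Finset.sum_mul]
  refine sum fun k _ => ?_
  rw [Finset.sum_mul, Finset.sum_mul]
  refine sum fun j hj => ?_
  refine ((((ofField _).mul (hv.pow j)).mul (hw.pow k)).mul (hu.pow i)).mono ?_
  linarith [h i j k (by simpa using hj)]

end WeightLE

lemma weightLE_x_iff {Φ : Tri F} {n : ℕ} : WeightLE 1 0 0 n Φ ↔ Φ.natDegree ≤ n := by
  rw [natDegree_le_iff_coeff_eq_zero]
  constructor
  · intro h i hi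
    ext k j
    by_contra hne
    have := h i j k (by simpa using hne)
    lia
  · intro h i j k hne
    by_contra hlt
    exact hne (by simp [h i (by lia)])

/-- The substitution `(x, y, z) ↦ (y, -x, z - x * y)`, which exchanges the two families of
lines. -/
noncomputable def swap : Tri F →ₐ[F] Tri F := subst y (-x) (z - x * y)

lemma swap_eq (Φ : Tri F) : swap Φ = subst y (-x) (z - x * y) Φ := rfl

lemma swap_swap (Φ : Tri F) : swap (swap Φ) = subst (-x) (-y) z Φ := by
  rw [swap_eq Φ, map_subst]
  simp [swap, mul_comm]

/-- The inverse of `swap`. -/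
noncomputable def unswap : Tri F →ₐ[F] Tri F := subst (-y) x (z - x * y)

lemma unswap_swap (Φ : Tri F) : unswap (swap Φ) = Φ := by
  rw [swap_eq Φ, map_subst]
  simp [unswap, mul_comm]

lemma swap_unswap (Φ : Tri F) : swap (unswap Φ) = Φ := by
  rw [unswap, map_subst]
  simp [swap, mul_comm]

lemma swap_ne_zero {Φ : Tri F} (h : Φ ≠ 0) : swap Φ ≠ 0 :=
  fun h0 => h (by rw [← unswap_swap Φ, h0, map_zero])

/-- Two swaps only change the signs of `x` and `y`. Hence `swap` turns bidegree `(m, n)` into `(n,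
m)`, and arguments for one family of lines transfer to the other. -/
lemma natDegree_swap_swap_le (Φ : Tri F) : (swap (swap Φ)).natDegree ≤ Φ.natDegree := by
  rw [← weightLE_x_iff, swap_swap]
  exact (weightLE_x_iff.2 le_rfl).subst (WeightLE.x le_rfl).neg (WeightLE.y le_rfl).neg
    (WeightLE.z le_rfl)

/-- In a polynomial of bidegree `(m, n)`, the variable `y` occurs in the coefficient of `x ^ i` with
exponent at most `i + n`. -/
lemma weightLE_of_swap {Φ : Tri F} {n : ℕ} (h : (swap Φ).natDegree ≤ n) :
    WeightLE (-1) 1 0 n Φ := by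
  rw [← unswap_swap Φ]
  refine (weightLE_x_iff.2 h).subst (WeightLE.y le_rfl).neg (WeightLE.x (by simp))
    ((WeightLE.z le_rfl).sub ?_)
  exact (WeightLE.x (N := -1) le_rfl).mul (WeightLE.y (N := 1) le_rfl)

/-- The coefficients with respect to `x` of a polynomial of bidegree `(m, n)` have total degree at
most `m + n`. -/
lemma weightLE_yz {Φ : Tri F} {m n : ℕ} (hm : Φ.natDegree ≤ m) (hn : (swap Φ).natDegree ≤ n) :
    WeightLE 0 1 1 (m + n) Φ := by
  -- This substitution makes both degree bounds visible at once: weights `(1, 0, 0)` give `m`,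
  -- weights `(-1, 1, 0)` give `n`, and their sum is the degree in `y`.
  have h1 : WeightLE 0 1 0 (m + n) (subst (x + z : Tri F) y (z * y) Φ) := by
    have hx : WeightLE 1 0 0 m (subst (x + z : Tri F) y (z * y) Φ) :=
      (weightLE_x_iff.2 hm).subst ((WeightLE.x le_rfl).add (WeightLE.z (by simp)))
        (WeightLE.y le_rfl) ((WeightLE.z (N := 0) le_rfl).mul (WeightLE.y (N := 0) le_rfl))
    have hy : WeightLE (-1) 1 0 n (subst (x + z : Tri F) y (z * y) Φ) := by
      have : subst (x + z : Tri F) y (z * y) Φ =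
          subst (-y : Tri F) (x + z) (-(x * y)) (swap Φ) := by
        rw [swap_eq, map_subst]
        congr 1
        simp
        congr 1
        ring
      rw [this]
      exact (weightLE_x_iff.2 hn).subst (WeightLE.y le_rfl).neg
        ((WeightLE.x (by simp)).add (WeightLE.z le_rfl))
        ((WeightLE.x (N := -1) le_rfl).mul (WeightLE.y (N := 1) le_rfl)).neg
    intro i j k hne
    linarith [hx i j k hne, hy i j k hne]
  have h2 : WeightLE 0 1 0 (m + n) (subst (x : Tri F) y (z * y) Φ) := by
    have : subst (x : Tri F) y (z * y) Φ = subst (x - z : Tri F) y z (subst (x + z : Tri F) y (z * y) Φ) := by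
      rw [map_subst]
      simp
    rw [this]
    exact h1.subst ((WeightLE.x le_rfl).sub (WeightLE.z le_rfl)) (WeightLE.y le_rfl)
      (WeightLE.z le_rfl)
  have h3 : subst (x : Tri F) y (z * y) Φ = Φ.map (compRingHom (C X * X)) := by
    have : subst (x : Tri F) y (z * y) = (mapAlgHom ((aeval (R := F[X]) (C X * X : F[X][X])).restrictScalars F)
        : Tri F →ₐ[F] Tri F) := by
      apply algHom_ext
      · rw [subst_x]; simp [x]
      · rw [subst_y]; simp [y]
      · rw [subst_z, mul_comm]; simp [y, z]
    exact DFunLike.congr_fun this Φ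
  intro i j k hne
  -- Under `z ↦ z * y` the monomial `y ^ j * z ^ k` becomes `y ^ (j + k) * z ^ k`, so the degree in
  -- `y` records the total degree.
  have := h2 i (j + k) k (by
    rw [h3, coeff_map]
    simp only [coe_compRingHom_apply, comp_C_mul_X_coeff]
    rw [coeff_mul_X_pow]
    exact hne)
  simpa [add_assoc] using this

end Basic

end Tri

/-! ### Functions of bounded degree on a line. -/

namespace FunDegreeLE

variable {F : Type*} [Field F] {f g : F → F} {m n : ℕ}

lemma mono (h : FunDegreeLE f m) (hmn : m ≤ n) : FunDegreeLE f n := by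
  obtain ⟨P, hP, h⟩ := h
  exact ⟨P, hP.trans hmn, h⟩

lemma const (r : F) (n : ℕ) : FunDegreeLE (fun _ => r) n := ⟨C r, by simp, by simp⟩

lemma id : FunDegreeLE (fun t : F => t) 1 := ⟨X, by simp, by simp⟩

lemma add (hf : FunDegreeLE f n) (hg : FunDegreeLE g n) : FunDegreeLE (fun t => f t + g t) n := by
  obtain ⟨P, hP, hf⟩ := hf
  obtain ⟨Q, hQ, hg⟩ := hg
  exact ⟨P + Q, natDegree_add_le_of_degree_le hP hQ, by simp [hf, hg]⟩

lemma mul (hf : FunDegreeLE f m) (hg : FunDegreeLE g n) :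
    FunDegreeLE (fun t => f t * g t) (m + n) := by
  obtain ⟨P, hP, hf⟩ := hf
  obtain ⟨Q, hQ, hg⟩ := hg
  exact ⟨P * Q, natDegree_mul_le.trans (add_le_add hP hQ), by simp [hf, hg]⟩

lemma const_mul (r : F) (hf : FunDegreeLE f n) : FunDegreeLE (fun t => r * f t) n := by
  simpa using (const r 0).mul hf

lemma pow (hf : FunDegreeLE f n) (k : ℕ) : FunDegreeLE (fun t => f t ^ k) (k * n) := by
  obtain ⟨P, hP, hf⟩ := hf
  exact ⟨P ^ k, natDegree_pow_le_of_le k hP, by simp [hf]⟩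

lemma sub (hf : FunDegreeLE f n) (hg : FunDegreeLE g n) : FunDegreeLE (fun t => f t - g t) n := by
  simpa [sub_eq_add_neg] using hf.add (hg.const_mul (-1))

lemma sum {ι : Type*} {s : Finset ι} {f : ι → F → F} (h : ∀ i ∈ s, FunDegreeLE (f i) n) :
    FunDegreeLE (fun t => ∑ i ∈ s, f i t) n := by
  classical
  induction s using Finset.induction_on with
  | empty => simpa using const (0 : F) n
  | insert i s hi ih =>
    simp only [Finset.sum_insert hi]
    exact (h i (by simp)).add (ih fun j hj => h j (by simp [hj]))

lemma comp_neg (hf : FunDegreeLE f n) : FunDegreeLE (fun t => f (-t)) n := by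
  obtain ⟨P, hP, hf⟩ := hf
  refine ⟨P.comp (-X), ?_, by simp [hf]⟩
  simpa [natDegree_comp] using hP

/-- If `∑ u l t * c ^ l` has degree at most `n` in `t` for every `c`, then so has every `u l`. -/
lemma of_sum_pow [Fintype F] {N : ℕ} (hN : N ≤ Fintype.card F) {u : ℕ → F → F}
    (h : ∀ c, FunDegreeLE (fun t => ∑ l ∈ Finset.range N, u l t * c ^ l) n) {l : ℕ} (hl : l < N) :
    FunDegreeLE (u l) n := by
  classical
  let U : F → F[X] := fun t => ∑ l ∈ Finset.range N, C (u l t) * X ^ l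
  have hdeg : ∀ t, (U t).degree < (Finset.univ : Finset F).card := by
    intro t
    refine lt_of_lt_of_le ?_ (Nat.cast_le.2 hN)
    refine (degree_sum_le _ _).trans_lt ((Finset.sup_lt_iff (WithBot.bot_lt_coe N)).2 fun k hk => ?_)
    exact (degree_C_mul_X_pow_le _ _).trans_lt (Nat.cast_lt.2 (Finset.mem_range.1 hk))
  -- Interpolation expresses each coefficient as a linear combination of the values at the points
  -- `c`, with weights independent of `t`.
  have key : ∀ t, u l t = ∑ c : F, (Lagrange.basis Finset.univ (fun c : F => c) c).coeff l *
      ∑ l ∈ Finset.range N, u l t * c ^ l := by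
    intro t
    have h1 : (U t).coeff l = u l t := by simp [U, finsetSum_coeff, coeff_X_pow, hl]
    have h2 := Lagrange.eq_interpolate (v := fun c : F => c) (Function.injective_id.injOn) (hdeg t)
    rw [← h1]
    conv_lhs => rw [h2]
    simp only [Lagrange.interpolate_apply, finsetSum_coeff, coeff_C_mul]
    refine Finset.sum_congr rfl fun c _ => ?_
    rw [mul_comm]
    simp [U, eval_finsetSum]
  rw [show u l = _ from funext key]
  exact sum fun c _ => (h c).const_mul _

end FunDegreeLE

/-! ### Polynomials of degree below the field size are determined by their values. -/

section Uniqueness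

variable {F : Type*} [Field F] [Fintype F]

lemma eq_of_eval_eq {P Q : F[X]} (hP : P.natDegree < Fintype.card F)
    (hQ : Q.natDegree < Fintype.card F) (h : ∀ t, P.eval t = Q.eval t) : P = Q :=
  eq_of_natDegree_lt_card_of_eval_eq P Q Function.injective_id h (max_lt hP hQ)

lemma natDegree_le_of_funDegreeLE {P : F[X]} {n : ℕ} (hP : P.natDegree < Fintype.card F)
    (hn : n < Fintype.card F) (h : FunDegreeLE (fun t => P.eval t) n) : P.natDegree ≤ n := by
  obtain ⟨Q, hQ, hPQ⟩ := h
  rwa [eq_of_eval_eq hP (hQ.trans_lt hn) hPQ]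

lemma eq_zero_of_evalEval_eq_zero {g : F[X][X]} (hg : g.natDegree < Fintype.card F)
    (hg' : ∀ k, (g.coeff k).natDegree < Fintype.card F) (h : ∀ b c, g.evalEval b c = 0) :
    g = 0 := by
  have key : ∀ b, g.map (evalRingHom b) = 0 := by
    intro b
    refine eq_of_eval_eq (natDegree_map_le.trans_lt hg) (by simpa using Fintype.card_pos) fun c => ?_
    rw [map_evalRingHom_eval, h b c, eval_zero]
  ext1 k
  refine eq_of_eval_eq (hg' k) (by simpa using Fintype.card_pos) fun b => ?_
  simpa using congrArg (fun P => P.coeff k) (key b)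

lemma exists_expansion (f : F → F → F → F) {n : ℕ}
    (hf : ∀ b c, FunDegreeLE (fun a => f a b c) n) :
    ∃ h : ℕ → F → F → F, (∀ k b, FunDegreeLE (fun a => h k a b) n) ∧
      ∀ a b c, f a b c = ∑ k ∈ Finset.range (Fintype.card F), h k a b * c ^ k := by
  classical
  refine ⟨fun k a b => ∑ c : F, (Lagrange.basis Finset.univ (fun c : F => c) c).coeff k * f a b c,
    fun k b => FunDegreeLE.sum fun c _ => (hf b c).const_mul _, fun a b c => ?_⟩
  have hinj : Set.InjOn (fun c : F => c) (Finset.univ : Finset F) := Function.injective_id.injOn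
  have h1 := Lagrange.eval_interpolate_at_node (f a b) hinj (Finset.mem_univ c)
  have h2 := Lagrange.degree_interpolate_lt (f a b) hinj
  rw [← h1, eval_eq_sum_range' (n := Fintype.card F)]
  · refine Finset.sum_congr rfl fun k _ => ?_
    simp [Lagrange.interpolate_apply, finsetSum_coeff, mul_comm]
  · by_cases h0 : Lagrange.interpolate Finset.univ (fun c : F => c) (f a b) = 0
    · rw [h0]; simpa using Fintype.card_pos
    · exact (natDegree_lt_iff_degree_lt h0).2 h2

end Uniqueness

/-! ### Restriction to lines, and bivariate functions as polynomials. -/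

namespace Tri

set_option maxSynthPendingDepth 10

variable {F : Type*} [Field F]

/-- The restriction of a polynomial to the line `y = b`, `z = c`. -/
noncomputable def line (b c : F) : Tri F →ₐ[F] F[X] := subst X (C b) (C c)

lemma eval_line (a b c : F) (Φ : Tri F) : (line b c Φ).eval a = subst a b c Φ := by
  have := map_subst X (C b) (C c) (aeval a) Φ
  simpa [line, coe_aeval_eq_eval] using this

lemma line_eq_map (b c : F) (Φ : Tri F) : line b c Φ = Φ.map (evalEvalRingHom b c) := by
  have : line b c = mapAlgHom ({ evalEvalRingHom b c with
      commutes' := fun r => by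
        rw [show algebraMap F F[X][X] r = C (C r) from rfl]
        simp [evalEvalRingHom] } : F[X][X] →ₐ[F] F) := by
    apply algHom_ext
    · rw [line, subst_x]; simp [x]
    · rw [line, subst_y]; simp [y, evalEvalRingHom]
    · rw [line, subst_z]; simp [z, evalEvalRingHom]
  exact DFunLike.congr_fun this Φ

lemma coeff_line (b c : F) (Φ : Tri F) (n : ℕ) :
    (line b c Φ).coeff n = (Φ.coeff n).evalEval b c := by
  simp [line_eq_map]

lemma natDegree_line_le (b c : F) (Φ : Tri F) : (line b c Φ).natDegree ≤ Φ.natDegree := by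
  rw [line_eq_map]
  exact natDegree_map_le

lemma subst_swap (a b c : F) (Φ : Tri F) :
    subst a b c (swap Φ) = subst b (-a) (c - a * b) Φ := by
  rw [swap_eq, map_subst]
  simp

lemma subst_ofY (a b c : F) (P : F[X]) : subst a b c (C (C P) : Tri F) = P.eval b := by
  simp [subst]

lemma WeightLE.ofY {w : ℕ} {P : F[X]} {a c : ℤ} {n : ℕ} (hP : P.natDegree ≤ n) :
    WeightLE a w c (w * n) (C (C P) : Tri F) := by
  intro i j k hne
  simp only [coeff_C] at hne
  split_ifs at hne with h1
  · simp only [coeff_C] at hne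
    split_ifs at hne with h2
    · subst h1 h2
      have := (le_natDegree_of_ne_zero hne).trans hP
      simp only [Nat.cast_zero, mul_zero, zero_add, add_zero]
      exact_mod_cast Nat.mul_le_mul_left w this
    · simp at hne
  · simp at hne

variable [Fintype F]

/-- A function of two variables of bounded degree in each of them is a polynomial. -/
lemma exists_of_degree_le {m n : ℕ} (hm : m < Fintype.card F) {u : F → F → F}
    (hx : ∀ b, FunDegreeLE (fun a => u a b) m) (hy : ∀ a, FunDegreeLE (fun b => u a b) n) :
    ∃ U : Tri F, WeightLE 1 0 0 m U ∧ WeightLE 0 1 0 n U ∧ WeightLE 0 0 1 0 U ∧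
      ∀ a b c, subst a b c U = u a b := by
  choose P hP hPu using hx
  have hsum : ∀ a b, u a b = ∑ i ∈ Finset.range (m + 1), (P b).coeff i * a ^ i := fun a b => by
    rw [show u a b = _ from hPu b a, eval_eq_sum_range' (Nat.lt_succ_of_le (hP b))]
  have hc : ∀ i ∈ Finset.range (m + 1), FunDegreeLE (fun b => (P b).coeff i) n := fun i hi =>
    FunDegreeLE.of_sum_pow (N := m + 1) hm (fun a => by simpa only [hsum] using hy a)
      (Finset.mem_range.1 hi)
  choose! p hp hpu using hc
  refine ⟨∑ i ∈ Finset.range (m + 1), C (C (p i)) * x ^ i, ?_, ?_, ?_, ?_⟩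
  · refine WeightLE.sum fun i hi => ?_
    have := Finset.mem_range.1 hi
    exact ((WeightLE.ofY (w := 0) (hp i hi)).mul ((WeightLE.x le_rfl).pow i)).mono (by lia)
  · refine WeightLE.sum fun i hi => ?_
    exact ((WeightLE.ofY (w := 1) (hp i hi)).mul ((WeightLE.x le_rfl).pow i)).mono (by lia)
  · refine WeightLE.sum fun i hi => ?_
    exact ((WeightLE.ofY (w := 0) (hp i hi)).mul ((WeightLE.x le_rfl).pow i)).mono (by lia)
  · intro a b c
    rw [map_sum, hsum]
    refine Finset.sum_congr rfl fun i hi => ?_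
    rw [map_mul, map_pow, subst_x, subst_ofY]
    exact congrArg (· * a ^ i) (hpu i hi b).symm

end Tri

/-! ### Codewords are polynomials of bounded bidegree. -/

namespace Tri

set_option maxSynthPendingDepth 10

variable {F : Type*} [Field F]

lemma sum_mul_add_pow (h : ℕ → F) (r c : F) (S : ℕ) :
    ∑ k ∈ Finset.range (S + 1), h k * (r + c) ^ k =
      ∑ l ∈ Finset.range (S + 1),
        (∑ k ∈ Finset.range (S + 1), (k.choose l : F) * (r ^ (k - l) * h k)) * c ^ l := by
  simp only [Finset.sum_mul]
  rw [Finset.sum_comm]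
  refine Finset.sum_congr rfl fun k hk => ?_
  rw [add_comm r c, add_pow, Finset.mul_sum]
  refine (Finset.sum_subset (Finset.range_mono (Finset.mem_range.1 hk)) ?_).trans ?_
  · intro l _ hl
    rw [Nat.choose_eq_zero_of_lt (by simpa using hl)]
    simp
  · exact Finset.sum_congr rfl fun l _ => by ring

lemma natDegree_zLine_le {Φ : Tri F} {N : ℕ} (h : WeightLE 0 1 1 N Φ) (a b : F) :
    (subst (C a) (C b) X Φ : F[X]).natDegree ≤ N := by
  rw [subst_eq_sum]
  refine natDegree_sum_le_of_forall_le _ _ fun i _ => ?_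
  rw [Finset.sum_mul]
  refine natDegree_sum_le_of_forall_le _ _ fun k _ => ?_
  rw [Finset.sum_mul, Finset.sum_mul]
  refine natDegree_sum_le_of_forall_le _ _ fun j hj => ?_
  have hk := h i j k (by simpa using hj)
  rw [algebraMap_eq, ← C_pow, ← C_pow, ← C_mul, mul_comm, ← mul_assoc, ← C_mul]
  exact (natDegree_C_mul_X_pow_le _ _).trans (by lia)

lemma eval_zLine (a b c : F) (Φ : Tri F) : (subst (C a) (C b) X Φ).eval c = subst a b c Φ := by
  have := map_subst (C a) (C b) X (aeval c) Φ
  simpa [coe_aeval_eq_eval] using this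

variable [Fintype F]

/-- All formal degrees are below the field size, so a coefficient of `x ^ i` vanishing at all points
`(b, c)` is the zero polynomial. -/
lemma natDegree_le_of_line {Φ : Tri F} {m n : ℕ} (hm : m < Fintype.card F)
    (hn : n < Fintype.card F) (hx : WeightLE 1 0 0 n Φ) (hy : WeightLE 0 1 0 n Φ)
    (hz : WeightLE 0 0 1 n Φ) (h : ∀ b c, FunDegreeLE (fun a : F => subst a b c Φ) m) :
    Φ.natDegree ≤ m := by
  have hx' := weightLE_x_iff.1 hx
  rw [natDegree_le_iff_coeff_eq_zero]
  intro i hi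
  refine eq_zero_of_evalEval_eq_zero (lt_of_le_of_lt ?_ hn) (fun k => lt_of_le_of_lt ?_ hn) ?_
  · rw [natDegree_le_iff_coeff_eq_zero]
    intro k hk
    ext j
    by_contra hne
    have := hz i j k (by simpa using hne)
    lia
  · rw [natDegree_le_iff_coeff_eq_zero]
    intro j hj
    by_contra hne
    have := hy i j k hne
    lia
  · intro b c
    rw [← coeff_line]
    refine coeff_eq_zero_of_natDegree_lt (lt_of_le_of_lt ?_ hi)
    refine natDegree_le_of_funDegreeLE (((natDegree_line_le b c Φ).trans hx').trans_lt hn) hm ?_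
    simpa only [eval_line] using h b c

/-- Expanding in powers of `z - x * y` instead of `z` gives coefficients of bounded degree in `x`
and in `y` separately, hence polynomials. The degree in `x` is at first only bounded by `max m n +
S`, but this is below the field size, so the values on `x`-lines bring it down to `m`. -/
lemma exists_of_short_expansion {m n S : ℕ} (hm : m + S < Fintype.card F)
    (hn : n + S < Fintype.card F) (h : ℕ → F → F → F)
    (hx : ∀ k b, FunDegreeLE (fun a => h k a b) m)
    (hy : ∀ a c, FunDegreeLE (fun b => ∑ k ∈ Finset.range (S + 1), h k a b * (a * b + c) ^ k) n) :
    ∃ Φ : Tri F, Φ.natDegree ≤ m ∧ (swap Φ).natDegree ≤ n ∧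
      ∀ a b c, subst a b c Φ = ∑ k ∈ Finset.range (S + 1), h k a b * c ^ k := by
  let u : ℕ → F → F → F := fun l a b =>
    ∑ k ∈ Finset.range (S + 1), (k.choose l : F) * ((a * b) ^ (k - l) * h k a b)
  have hu : ∀ a b c, ∑ k ∈ Finset.range (S + 1), h k a b * (a * b + c) ^ k =
      ∑ l ∈ Finset.range (S + 1), u l a b * c ^ l := fun a b c =>
    sum_mul_add_pow (fun k => h k a b) (a * b) c S
  have hU : ∀ l ∈ Finset.range (S + 1), ∃ U : Tri F, WeightLE 1 0 0 (m + (S - l) : ℕ) U ∧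
      WeightLE 0 1 0 n U ∧ WeightLE 0 0 1 0 U ∧ ∀ a b c, subst a b c U = u l a b := by
    intro l hl
    refine exists_of_degree_le (by lia) (fun b => ?_) fun a => ?_
    · refine FunDegreeLE.sum fun k hk => FunDegreeLE.const_mul _ ?_
      have h1 : FunDegreeLE (fun a : F => (a * b) ^ (k - l)) ((k - l) * 1) :=
        FunDegreeLE.pow (by simpa [mul_comm] using FunDegreeLE.id.const_mul b) _
      refine (h1.mul (hx k b)).mono ?_
      have := Finset.mem_range.1 hk
      lia
    · exact FunDegreeLE.of_sum_pow (N := S + 1) (u := fun l b => u l a b) (by lia)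
        (fun c => by simpa only [← hu] using hy a c) (Finset.mem_range.1 hl)
  choose! U hUx hUy hUz hUu using hU
  have hw : ∀ (α β γ N : ℤ), α + β ≤ N → γ ≤ N → WeightLE α β γ N (z - x * y : Tri F) :=
    fun α β γ N h1 h2 => (WeightLE.z h2).sub
      (((WeightLE.x (N := α) le_rfl).mul (WeightLE.y (N := β) le_rfl)).mono h1)
  have hΦ : ∀ a b c, subst a b c (∑ l ∈ Finset.range (S + 1), U l * (z - x * y) ^ l) =
      ∑ k ∈ Finset.range (S + 1), h k a b * c ^ k := by
    intro a b c
    have := hu a b (c - a * b)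
    rw [add_sub_cancel] at this
    rw [this, map_sum]
    refine Finset.sum_congr rfl fun l hl => ?_
    rw [map_mul, hUu l hl]
    simp
  refine ⟨∑ l ∈ Finset.range (S + 1), U l * (z - x * y) ^ l, ?_, ?_, hΦ⟩
  · refine natDegree_le_of_line (n := max m n + S) (by lia) (by lia) ?_ ?_ ?_ fun b c => ?_
    · refine WeightLE.sum fun l hl =>
        ((hUx l hl).mul ((hw _ _ _ 1 le_rfl (by simp)).pow l)).mono ?_
      have := Finset.mem_range.1 hl
      lia
    · refine WeightLE.sum fun l hl =>
        ((hUy l hl).mul ((hw _ _ _ 1 le_rfl (by simp)).pow l)).mono ?_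
      have := Finset.mem_range.1 hl
      lia
    · refine WeightLE.sum fun l hl =>
        ((hUz l hl).mul ((hw _ _ _ 1 (by simp) (by simp)).pow l)).mono ?_
      have := Finset.mem_range.1 hl
      lia
    · simp only [hΦ]
      refine FunDegreeLE.sum fun k _ => ?_
      simpa only [mul_comm] using (hx k b).const_mul (c ^ k)
  · rw [← weightLE_x_iff, map_sum]
    refine WeightLE.sum fun l hl => ?_
    have h1 : WeightLE 1 0 0 n (swap (U l)) := by
      have : WeightLE 0 1 1 n (U l) := fun i j k hne => by
        have := hUy l hl i j k hne
        have := hUz l hl i j k hne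
        lia
      exact this.subst (WeightLE.y le_rfl) (WeightLE.x le_rfl).neg (hw _ _ _ _ (by simp) (by simp))
    have h2 : swap (z - x * y : Tri F) = z := by simp [swap, mul_comm]
    rw [map_mul, map_pow, h2]
    exact (h1.mul ((WeightLE.z le_rfl).pow l)).mono (by simp)

/-- Induction on the length of the expansion in `z`. The shift `z ↦ z + 1` preserves both families
of lines, and the difference of the shifted and original functions has a shorter expansion, so it is
a polynomial by induction. Its degree in `z` is at most `m + n`, while its coefficient of `z ^ (K -
1)` is `K * h K`. Since `K - 1 > m + n` and `K` is invertible, `h K = 0`. -/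
lemma exists_of_expansion {m n K : ℕ} (hm : 2 * m + n + 2 ≤ Fintype.card F)
    (hn : m + 2 * n + 2 ≤ Fintype.card F)
    (hchar : ∀ k : ℕ, 0 < k → k < Fintype.card F → (k : F) ≠ 0)
    (hK : m + n + 2 ≤ K) (hK' : K ≤ Fintype.card F) :
    ∀ h : ℕ → F → F → F, (∀ k b, FunDegreeLE (fun a => h k a b) m) →
      (∀ a c, FunDegreeLE (fun b => ∑ k ∈ Finset.range K, h k a b * (a * b + c) ^ k) n) →
      ∃ Φ : Tri F, Φ.natDegree ≤ m ∧ (swap Φ).natDegree ≤ n ∧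
        ∀ a b c, subst a b c Φ = ∑ k ∈ Finset.range K, h k a b * c ^ k := by
  induction K, hK using Nat.le_induction with
  | base =>
    intro h hx hy
    exact exists_of_short_expansion (S := m + n + 1) (by lia) (by lia) h hx hy
  | succ K hK ih =>
    intro h hx hy
    specialize ih (by lia)
    -- The coefficients in `c` of `f (a, b, 1 + c) - f (a, b, c)`.
    let h' : ℕ → F → F → F := fun l a b =>
      ∑ k ∈ Finset.range (K + 1), (k.choose l : F) * (1 ^ (k - l) * h k a b) - h l a b
    have hdiff : ∀ a b c, ∑ k ∈ Finset.range K, h' k a b * c ^ k =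
        ∑ k ∈ Finset.range (K + 1), h k a b * (1 + c) ^ k -
          ∑ k ∈ Finset.range (K + 1), h k a b * c ^ k := by
      intro a b c
      have hK0 : h' K a b = 0 := by
        simp only [h']
        rw [Finset.sum_range_succ, Finset.sum_eq_zero fun k hk => ?_]
        · simp
        · rw [Nat.choose_eq_zero_of_lt (Finset.mem_range.1 hk)]; simp
      rw [sum_mul_add_pow (fun k => h k a b) 1 c K, ← Finset.sum_sub_distrib]
      simp only [← sub_mul]
      rw [Finset.sum_range_succ _ K]
      change _ = _ + h' K a b * _
      rw [hK0, zero_mul, add_zero]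
    obtain ⟨Ψ, hΨm, hΨn, hΨ⟩ := ih h' (fun k b => (FunDegreeLE.sum fun j _ => by
        simpa using (hx j b).const_mul _).sub (hx k b)) (fun a c => by
        have h1 := (hy a (1 + c)).sub (hy a c)
        simp only [hdiff]
        convert h1 using 6
        ring)
    have htop : ∀ a b, h K a b = 0 := by
      intro a b
      have hdeg : (subst (C a) (C b) X Ψ : F[X]).natDegree ≤ m + n :=
        natDegree_zLine_le (N := m + n) (by exact_mod_cast weightLE_yz hΨm hΨn) a b
      have hline : subst (C a) (C b) X Ψ = ∑ k ∈ Finset.range K, C (h' k a b) * X ^ k := by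
        refine eq_of_eval_eq (by lia) (lt_of_le_of_lt (b := K - 1) ?_ (by lia)) fun c => ?_
        · refine natDegree_sum_le_of_forall_le _ _ fun k hk => ?_
          have := Finset.mem_range.1 hk
          exact (natDegree_C_mul_X_pow_le _ _).trans (by lia)
        · rw [eval_zLine, hΨ]
          simp [eval_finsetSum]
      have h1 : h' (K - 1) a b = 0 := by
        have h0 : (subst (C a) (C b) X Ψ : F[X]).coeff (K - 1) = 0 :=
          coeff_eq_zero_of_natDegree_lt (by lia)
        have := congrArg (fun P => P.coeff (K - 1)) hline
        simp only [h0] at this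
        simpa [finsetSum_coeff, coeff_X_pow, show 0 < K by lia] using this.symm
      obtain ⟨L, rfl⟩ : ∃ L, K = L + 1 := ⟨K - 1, by lia⟩
      have h2 : h' L a b = ((L + 1 : ℕ) : F) * h (L + 1) a b := by
        simp only [h']
        rw [Finset.sum_range_succ, Finset.sum_range_succ, Finset.sum_eq_zero fun k hk => ?_]
        · simp
        · rw [Nat.choose_eq_zero_of_lt (Finset.mem_range.1 hk)]; simp
      rw [Nat.add_sub_cancel, h2] at h1
      exact (mul_eq_zero.1 h1).resolve_left (hchar _ (by lia) (by lia))
    have hred : ∀ a b c, ∑ k ∈ Finset.range (K + 1), h k a b * c ^ k =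
        ∑ k ∈ Finset.range K, h k a b * c ^ k := fun a b c => by
      rw [Finset.sum_range_succ, htop, zero_mul, add_zero]
    simp only [hred] at hy ⊢
    exact ih h hx hy

/-- The elements of the local code are the polynomials of bounded bidegree. -/
lemma exists_of_mem_localCode {m n : ℕ} (hm : 2 * m + n + 2 ≤ Fintype.card F)
    (hn : m + 2 * n + 2 ≤ Fintype.card F)
    (hchar : ∀ k : ℕ, 0 < k → k < Fintype.card F → (k : F) ≠ 0) {f : F × F × F → F}
    (hf : f ∈ localCode F m n) :
    ∃ Φ : Tri F, Φ.natDegree ≤ m ∧ (swap Φ).natDegree ≤ n ∧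
      ∀ a b c, subst a b c Φ = f (a, b, c) := by
  obtain ⟨h, hh, hsum⟩ := exists_expansion (fun a b c => f (a, b, c)) hf.1
  obtain ⟨Φ, h1, h2, h3⟩ := exists_of_expansion hm hn hchar (by lia) le_rfl h hh
    (fun a c => by simp only [← hsum]; exact hf.2 a c)
  exact ⟨Φ, h1, h2, fun a b c => by rw [h3, hsum]⟩

end Tri

/-! ### Resultants: nonvanishing, degree and multiplicity of roots. -/

section Resultant

/-- A kernel vector of the Sylvester matrix is a relation `f * q + g * p = 0` with `deg p < deg f`;
coprimality gives `f ∣ p`, hence `p = q = 0`. -/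
lemma resultant_ne_zero_of_isRelPrime {S : Type*} [CommRing S] [IsDomain S]
    [UniqueFactorizationMonoid S] {f g : S[X]} {n : ℕ} (hf : 0 < f.natDegree)
    (hg : g.natDegree ≤ n) (h : IsRelPrime f g) : resultant f g f.natDegree n ≠ 0 := by
  intro h0
  obtain ⟨v, hv, hMv⟩ := Matrix.exists_mulVec_eq_zero_iff.2 h0
  rw [← toMatrix_sylvesterMap' f g le_rfl hg] at hMv
  set b₁ := (((degreeLT.basis S f.natDegree).prod (degreeLT.basis S n)).reindex finSumFinEquiv)
  have hx := LinearMap.toMatrix_mulVec_repr b₁ (degreeLT.basis S (f.natDegree + n))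
    (sylvesterMap f g le_rfl hg) (b₁.equivFun.symm v)
  rw [show (b₁.repr (b₁.equivFun.symm v) : _ → S) = v from b₁.equivFun.apply_symm_apply v, hMv] at hx
  have hL : sylvesterMap f g le_rfl hg (b₁.equivFun.symm v) = 0 := by
    apply (degreeLT.basis S (f.natDegree + n)).repr.injective
    ext i
    simpa using (congrFun hx i).symm
  have hne : b₁.equivFun.symm v ≠ 0 := (LinearEquiv.map_ne_zero_iff _).2 hv
  obtain ⟨⟨⟨p, hp⟩, ⟨q, hq⟩⟩, hpq⟩ : ∃ w, w = b₁.equivFun.symm v := ⟨_, rfl⟩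
  rw [← hpq] at hL hne
  have hL' : f * q + g * p = 0 := congrArg Subtype.val hL
  have hfp : f ∣ p := by
    refine h.dvd_of_dvd_mul_left (Dvd.intro (-q) ?_)
    linear_combination -hL'
  have hp0 : p = 0 := by
    refine eq_zero_of_dvd_of_degree_lt hfp ?_
    rw [degree_eq_natDegree (show f ≠ 0 by rintro rfl; simp at hf)]
    exact mem_degreeLT.1 hp
  have hq0 : q = 0 := by
    rw [hp0, mul_zero, add_zero] at hL'
    exact (mul_eq_zero.1 hL').resolve_left (by rintro rfl; simp at hf)
  subst hp0 hq0
  exact hne rfl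

/-- Raising the formal degree of `g` contributes only a power of the leading coefficient of `f`,
which the shift leaves unchanged. -/
lemma resultant_taylor_of_le {S : Type*} [CommRing S] (f g : S[X]) (r : S) {n : ℕ}
    (hg : g.natDegree ≤ n) :
    resultant (f.taylor r) (g.taylor r) f.natDegree n = resultant f g f.natDegree n := by
  obtain ⟨k, rfl⟩ := Nat.exists_eq_add_of_le hg
  rw [resultant_add_right_deg _ _ _ _ _ (natDegree_taylor g r).le,
    resultant_add_right_deg _ _ _ _ _ le_rfl]
  have h1 : (f.taylor r).coeff f.natDegree = f.coeff f.natDegree := by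
    simp [coeff_taylor_natDegree]
  have h2 := resultant_taylor f g r
  rw [natDegree_taylor, natDegree_taylor] at h2
  rw [h1, h2]

variable {A : Type*} [CommRing A]

lemma natDegree_det_le {ι : Type*} [Fintype ι] [DecidableEq ι] (M : Matrix ι ι A[X])
    (r c : ι → ℤ) {N : ℕ} (h : ∀ i j, M i j ≠ 0 → ((M i j).natDegree : ℤ) ≤ r i + c j)
    (hN : ∑ i, r i + ∑ i, c i ≤ N) : M.det.natDegree ≤ N := by
  rw [Matrix.det_apply]
  refine natDegree_sum_le_of_forall_le _ _ fun σ _ => ?_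
  refine (natDegree_smul_le _ _).trans ?_
  by_cases h0 : ∃ i, M (σ i) i = 0
  · obtain ⟨i, hi⟩ := h0
    rw [Finset.prod_eq_zero (f := fun i => M (σ i) i) (Finset.mem_univ i) hi]
    simp
  · push Not at h0
    refine (natDegree_prod_le _ _).trans ?_
    zify
    refine (Finset.sum_le_sum fun i _ => h _ _ (h0 i)).trans ?_
    rw [Finset.sum_add_distrib, Equiv.sum_comp σ r]
    exact hN

lemma natDegree_resultant_le (f g : A[X][X]) {m n a b w : ℕ}
    (hf : ∀ i, (f.coeff i).natDegree ≤ w * i + a) (hg : ∀ i, (g.coeff i).natDegree ≤ w * i + b) :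
    (resultant f g m n).natDegree ≤ w * (m * n) + n * a + m * b := by
  -- In the Sylvester matrix the coefficient of index `i - j` stands in row `i` of the `j`-th column
  -- of its block, so its degree bound splits into a row and a column weight.
  refine natDegree_det_le _ (fun i : Fin (m + n) => w * (i : ℕ))
    (fun j : Fin (m + n) => j.addCases (fun j => (b : ℤ) - w * (j : ℕ)) (fun j => (a : ℤ) - w * (j : ℕ))) ?_ ?_
  · intro i j
    induction j using Fin.addCases with
    | left j =>
      simp only [sylvester, Matrix.of_apply, Fin.addCases_left]
      split_ifs with hij
      · intro _
        have h1 := hg (i - j)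
        have h2 : (j : ℕ) ≤ i := hij.1
        zify [h2] at h1
        linarith
      · simp
    | right j =>
      simp only [sylvester, Matrix.of_apply, Fin.addCases_right]
      split_ifs with hij
      · intro _
        have h1 := hf (i - j)
        have h2 : (j : ℕ) ≤ i := hij.1
        zify [h2] at h1
        linarith
      · simp
  · rw [Fin.sum_univ_add, Fin.sum_univ_add]
    simp only [Fin.addCases_left, Fin.addCases_right, Fin.val_castAdd, Fin.val_natAdd,
      Finset.sum_sub_distrib, Finset.sum_const, Finset.card_univ, Fintype.card_fin, nsmul_eq_mul,
      Nat.cast_add, mul_add, Finset.sum_add_distrib]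
    push_cast
    linarith

/-- Modulo `X - C t`, `g` is a multiple of `f`. Subtracting that multiple preserves the resultant
and makes the second argument divisible by `X - C t`, which comes out to the power `m`. -/
lemma pow_dvd_resultant (f g : A[X][X]) {m n : ℕ} (t : A) (P : A[X])
    (hf : f.natDegree ≤ m) (hP : P.natDegree + m ≤ n)
    (h : g.map (evalRingHom t) = f.map (evalRingHom t) * P) :
    (X - C t) ^ m ∣ resultant f g m n := by
  obtain ⟨g', hg'⟩ : C (X - C t) ∣ g - f * P.map C := by
    rw [C_dvd_iff_dvd_coeff]
    intro i
    rw [dvd_iff_isRoot, IsRoot.def, ← coe_evalRingHom, ← coeff_map, Polynomial.map_sub,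
      Polynomial.map_mul, Polynomial.map_map, h]
    have : (evalRingHom t).comp C = RingHom.id A := by ext; simp
    simp [this]
  have : g = C (X - C t) * g' + f * P.map C := by rw [← hg']; ring
  rw [this, resultant_add_mul_right _ _ _ _ _ (le_trans (by gcongr; exact natDegree_map_le) hP) hf,
    resultant_C_mul_right]
  exact dvd_mul_right _ _

end Resultant

/-! ### Plane sections and the intersection count. -/

namespace Tri

set_option maxSynthPendingDepth 10

variable {F : Type*} [Field F]

/-- The substitution `(x, y, z) ↦ (x + α, y, z + α * y + β)`, which preserves the two families of
lines. -/
noncomputable def translate (α β : F) : Tri F →ₐ[F] Tri F :=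
  subst (x + algebraMap F _ α) y (z + (algebraMap F _ α * y + algebraMap F _ β))

lemma natDegree_translate_le (α β : F) (Φ : Tri F) :
    (translate α β Φ).natDegree ≤ Φ.natDegree := by
  rw [← weightLE_x_iff]
  exact (weightLE_x_iff.2 le_rfl).subst ((WeightLE.x le_rfl).add (WeightLE.const _ (by simp)))
    (WeightLE.y le_rfl) ((WeightLE.z le_rfl).add
      (((WeightLE.ofField _).mul (WeightLE.y (N := 0) le_rfl)).add (WeightLE.ofField _)))

lemma natDegree_swap_translate_le (α β : F) (Φ : Tri F) :
    (swap (translate α β Φ)).natDegree ≤ (swap Φ).natDegree := by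
  have : swap (translate α β Φ) =
      subst x (y + algebraMap F _ α) (z + algebraMap F _ β) (swap Φ) := by
    rw [swap_eq Φ, translate, map_subst, map_subst]
    simp only [swap, map_add, map_mul, map_sub, map_neg, subst_x, subst_y, subst_z,
      AlgHom.commutes]
    congr 2
    ring
  rw [this, ← weightLE_x_iff]
  exact (weightLE_x_iff.2 le_rfl).subst (WeightLE.x le_rfl)
    ((WeightLE.y le_rfl).add (WeightLE.ofField _)) ((WeightLE.z le_rfl).add (WeightLE.ofField _))

lemma line_translate (α β b c : F) (Φ : Tri F) :
    line b c (translate α β Φ) = (line b (c + (α * b + β)) Φ).comp (X + C α) := by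
  rw [comp_eq_aeval, line, line, map_subst, translate, map_subst]
  simp only [map_add, map_mul, subst_x, subst_y, subst_z, AlgHom.commutes, algebraMap_eq, aeval_X,
    aeval_C]

/-- The restriction of a polynomial to the plane `z = 0`. -/
noncomputable def slice : Tri F →+* F[X][X] := mapRingHom (evalRingHom 0)

lemma coeff_slice (Φ : Tri F) (i : ℕ) : (slice Φ).coeff i = (Φ.coeff i).coeff 0 := by
  simp [slice, coeff_zero_eq_eval_zero]

lemma natDegree_slice_le (Φ : Tri F) : (slice Φ).natDegree ≤ Φ.natDegree := natDegree_map_le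

lemma map_slice (b : F) (Φ : Tri F) : (slice Φ).map (evalRingHom b) = line b 0 Φ := by
  rw [slice, coe_mapRingHom, Polynomial.map_map, line_eq_map]
  simp [evalEvalRingHom]

lemma natDegree_coeff_slice_le {Φ : Tri F} {n : ℕ} (h : (swap Φ).natDegree ≤ n) (i : ℕ) :
    ((slice Φ).coeff i).natDegree ≤ i + n := by
  rw [coeff_slice, natDegree_le_iff_coeff_eq_zero]
  intro j hj
  by_contra hne
  have := weightLE_of_swap h i j 0 hne
  lia

lemma translate_eq (α β : F) (Φ : Tri F) : translate α β Φ =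
    (taylor (C (C α)) Φ).map (compRingHom (X + C (C α * X + C β))) := by
  have : translate α β = (mapAlgHom ((aeval (R := F[X]) (X + C (C α * X + C β) :
      F[X][X])).restrictScalars F)).comp ((taylorAlgHom (C (C α))).restrictScalars F) := by
    apply algHom_ext
    · rw [translate, subst_x]
      simp [x, show algebraMap F (Tri F) α = C (C (C α)) from rfl]
    · rw [translate, subst_y]
      simp [y]
    · rw [translate, subst_z]
      simp [z, y, show ∀ α, algebraMap F (Tri F) α = C (C (C α)) from fun _ => rfl]
  exact DFunLike.congr_fun this Φ

/-- Up to a shift of `x`, this is the restriction to the plane `z = α * y + β`. -/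
lemma slice_translate (α β : F) (Φ : Tri F) : slice (translate α β Φ) =
    (taylor (C (C α)) Φ).map (evalRingHom (C α * X + C β)) := by
  rw [translate_eq, slice, coe_mapRingHom, Polynomial.map_map]
  congr 1
  ext <;> simp

lemma natDegree_coeff_le {Φ : Tri F} {m n : ℕ} (hm : Φ.natDegree ≤ m)
    (hn : (swap Φ).natDegree ≤ n) (i : ℕ) : (Φ.coeff i).natDegree ≤ m + n := by
  rw [natDegree_le_iff_coeff_eq_zero]
  intro k hk
  ext j
  by_contra hne
  have := weightLE_yz hm hn i j k (by simpa using hne)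
  lia

variable [Fintype F]

/-- Intersection count in the plane `z = 0`. -/
lemma mul_card_le_of_slice {G E P : Tri F} {m n a b : ℕ} (hE : E.natDegree ≤ m)
    (hEs : (swap E).natDegree ≤ a) (hPs : (swap P).natDegree ≤ b) (hG : slice G ≠ 0)
    (hR : resultant (slice E) (slice P) m n ≠ 0)
    (hX : ∀ t, ∃ A : F[X], A.natDegree + m ≤ n ∧ line t 0 (G * P) = line t 0 (G * E) * A) :
    m * (Fintype.card F - (G.natDegree + (swap G).natDegree)) ≤ m * n + n * a + m * b := by
  classical
  -- `G` can be cancelled only on lines where it is not identically zero. The roots of one nonzero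
  -- coefficient contain all the bad `t`.
  obtain ⟨i, hi⟩ : ∃ i, (slice G).coeff i ≠ 0 := by
    by_contra! h
    exact hG (Polynomial.ext fun i => by simpa using h i)
  set g := (slice G).coeff i with hg
  have hgdeg : g.natDegree ≤ G.natDegree + (swap G).natDegree := by
    refine (natDegree_coeff_slice_le le_rfl i).trans ?_
    have := (le_natDegree_of_ne_zero hi).trans (natDegree_slice_le G)
    lia
  set B : Finset F := Finset.univ \ g.roots.toFinset with hB
  have hBcard : Fintype.card F - (G.natDegree + (swap G).natDegree) ≤ B.card := by
    have h1 := Finset.le_card_sdiff g.roots.toFinset (Finset.univ : Finset F)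
    have h2 := (Multiset.toFinset_card_le g.roots).trans (card_roots' g)
    rw [Finset.card_univ] at h1
    lia
  have hdvd : ∀ t ∈ B, (X - C t) ^ m ∣ resultant (slice E) (slice P) m n := by
    intro t ht
    obtain ⟨A, hA, hline⟩ := hX t
    refine pow_dvd_resultant _ _ t A ((natDegree_slice_le E).trans hE) hA ?_
    rw [map_slice, map_slice]
    have hG0 : line t 0 G ≠ 0 := by
      intro h0
      have h1 : g.eval t = 0 := by
        rw [← map_slice] at h0
        simpa using congrArg (fun P => P.coeff i) h0
      simp [hB, hi, h1] at ht
    rw [map_mul, map_mul, mul_assoc] at hline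
    exact mul_left_cancel₀ hG0 hline
  have hprod : ∏ t ∈ B, (X - C t) ^ m ∣ resultant (slice E) (slice P) m n := by
    refine Finset.prod_dvd_of_coprime (fun s _ t _ hst => ?_) hdvd
    exact (pairwise_coprime_X_sub_C Function.injective_id hst).pow
  have hdeg := natDegree_le_of_dvd hprod hR
  rw [natDegree_prod_of_monic _ _ fun t _ => (monic_X_sub_C t).pow m] at hdeg
  simp only [natDegree_pow, natDegree_X_sub_C, mul_one, Finset.sum_const, smul_eq_mul] at hdeg
  have hres := natDegree_resultant_le (slice E) (slice P) (m := m) (n := n) (w := 1) (a := a)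
    (b := b) (by simpa using natDegree_coeff_slice_le hEs)
    (by simpa using natDegree_coeff_slice_le hPs)
  calc _ ≤ m * B.card := Nat.mul_le_mul_left _ hBcard
    _ = B.card * m := mul_comm _ _
    _ ≤ _ := hdeg.trans (by simpa using hres)

/-- If `E` had positive degree `e` in `x`, its resultant with `P` would be nonzero. On a suitable
plane it has degree at most `e * (2 * n + b)`, yet has a root of multiplicity `e` at more than `2 *
n + b` values of `y`. -/
lemma natDegree_eq_zero_of_line_dvd {G E P : Tri F} {n b : ℕ} (hG : G ≠ 0)
    (hrel : IsRelPrime E P) (hP : P.natDegree ≤ n) (hPs : (swap P).natDegree ≤ b)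
    (hX : ∀ s t, ∃ A : F[X], A.natDegree + E.natDegree ≤ n ∧
      line s t (G * P) = line s t (G * E) * A)
    (hle : (swap E).natDegree ≤ E.natDegree)
    (hq : G.natDegree + (swap G).natDegree + 2 * n + b < Fintype.card F) :
    E.natDegree = 0 := by
  by_contra h0
  have hpos : 0 < E.natDegree := Nat.pos_of_ne_zero h0
  have hEn : E.natDegree ≤ n := by
    obtain ⟨A, hA, -⟩ := hX 0 0
    lia
  have hR := resultant_ne_zero_of_isRelPrime hpos hP hrel
  have hdeg : (resultant E P E.natDegree n * G.leadingCoeff).natDegree < Fintype.card (F × F) := by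
    have h1 := natDegree_resultant_le E P (m := E.natDegree) (n := n) (w := 0)
      (a := E.natDegree + E.natDegree) (b := n + b)
      (by simpa using natDegree_coeff_le le_rfl hle) (by simpa using natDegree_coeff_le hP hPs)
    have h2 : G.leadingCoeff.natDegree ≤ _ := natDegree_coeff_le le_rfl le_rfl _
    refine (natDegree_mul_le.trans (add_le_add h1 h2)).trans_lt ?_
    rw [Fintype.card_prod]
    nlinarith
  -- The planes `z = α * y + β` are `card F ^ 2` distinct substitutions for `z`, more than the
  -- degree in `z`. The factor `G.leadingCoeff` keeps `G` nonzero on the chosen plane.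
  obtain ⟨⟨α, β⟩, hαβ⟩ : ∃ r : F × F,
      (resultant E P E.natDegree n * G.leadingCoeff).eval (C r.1 * X + C r.2) ≠ 0 := by
    by_contra! h
    refine mul_ne_zero hR (leadingCoeff_ne_zero.2 hG) ?_
    refine eq_zero_of_natDegree_lt_card_of_eval_eq_zero _ (f := fun r : F × F => C r.1 * X + C r.2)
      ?_ h hdeg
    rintro ⟨α, β⟩ ⟨α', β'⟩ h
    have h1 := congrArg (fun P : F[X] => P.coeff 1) h
    have h2 := congrArg (fun P : F[X] => P.coeff 0) h
    simp at h1 h2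
    simp [h1, h2]
  rw [eval_mul] at hαβ
  have key := mul_card_le_of_slice (G := translate α β G) (E := translate α β E)
    (P := translate α β P) (m := E.natDegree) (n := n) (a := E.natDegree) (b := b)
    (natDegree_translate_le _ _ _) ((natDegree_swap_translate_le _ _ _).trans hle)
    ((natDegree_swap_translate_le _ _ _).trans hPs) ?_ ?_ ?_
  · have h1 := natDegree_translate_le α β G
    have h2 := natDegree_swap_translate_le α β G
    have h3 : 2 * n + b < Fintype.card F -
      ((translate α β G).natDegree + (swap (translate α β G)).natDegree) := by lia
    have h4 := Nat.mul_lt_mul_of_pos_left h3 hpos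
    nlinarith
  · rw [slice_translate]
    intro h
    have h1 := congrArg (fun P => P.coeff G.natDegree) h
    simp only [coeff_map, coeff_taylor_natDegree, coeff_zero] at h1
    exact right_ne_zero_of_mul hαβ h1
  · rw [slice_translate, slice_translate, resultant_map_map, resultant_taylor_of_le _ _ _ hP]
    exact left_ne_zero_of_mul hαβ
  · intro t
    obtain ⟨A, hA, h⟩ := hX t (0 + (α * t + β))
    refine ⟨A.comp (X + C α), ?_, ?_⟩
    · simpa [natDegree_comp] using hA
    · rw [← map_mul, ← map_mul, line_translate, line_translate, h, mul_comp]

end Tri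

/-! ### Counting polynomials of bidegree at most `(d, d)`. -/

namespace Tri

set_option maxSynthPendingDepth 10

variable {F : Type*} [Field F]

/-- The Laurent monomials `x ^ n * (z - w) ^ max (-n) 0 * z ^ p * w ^ q` are linearly
independent. -/
lemma eq_zero_of_sum_laurent {ι : Type*} [Fintype ι] {n : ι → ℤ} {p q : ι → ℕ}
    (hinj : ∀ i j, n i = n j → p i = p j → q i = q j → i = j) {c : ι → F}
    (h : ∑ i, c i • (AddMonoidAlgebra.single (n i)
      ((X - C X) ^ (-n i).toNat * (X ^ p i * C X ^ q i)) : AddMonoidAlgebra F[X][X] ℤ) = 0)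
    (i₀ : ι) : c i₀ = 0 := by
  classical
  have h1 := congrArg (fun f : AddMonoidAlgebra F[X][X] ℤ => f.coeff (n i₀)) h
  have h2 : (X - C X : F[X][X]) ^ (-n i₀).toNat *
      ∑ i, (if n i = n i₀ then c i • (X ^ p i * C X ^ q i : F[X][X]) else 0) = 0 := by
    refine Eq.trans ?_ (h1.trans (by simp))
    simp only [AddMonoidAlgebra.coeff_sum, Finset.mul_sum, Finsupp.finsetSum_apply,
      AddMonoidAlgebra.coeff_smul, Finsupp.smul_apply, AddMonoidAlgebra.coeff_single,
      Finsupp.single_apply]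
    refine Finset.sum_congr rfl fun i _ => ?_
    split_ifs with hi
    · rw [hi, mul_smul_comm]
    · simp
  have h3 := (mul_eq_zero.1 h2).resolve_left (pow_ne_zero _ (X_sub_C_ne_zero _))
  have h4 := congrArg (fun f : F[X][X] => (f.coeff (p i₀)).coeff (q i₀)) h3
  simp only [finsetSum_coeff, coeff_zero] at h4
  rw [Finset.sum_eq_single i₀ _ (by simp)] at h4
  · rwa [if_pos rfl, coeff_smul, coeff_smul, ← C_pow, coeff_mul_C, coeff_X_pow, if_pos rfl, one_mul,
      coeff_X_pow, if_pos rfl, smul_eq_mul, mul_one] at h4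
  · intro i _ hi
    split_ifs with hn
    · rw [coeff_smul, coeff_smul, ← C_pow, coeff_mul_C, coeff_X_pow]
      split_ifs with hp
      · rw [one_mul, coeff_X_pow, if_neg fun hq => hi (hinj _ _ hn hp.symm hq.symm), smul_zero]
      · simp
    · simp

/-- A basis of the polynomials of bidegree at most `(d, d)`. -/
noncomputable def basisMonomial (d : ℕ) (i : Fin (d + 1) × Fin (d + 1) × Fin (d + 1)) : Tri F :=
  -- With `w = z - x * y`, `swap` exchanges `z` and `w`. The monomials `x ^ s * w ^ t * z ^ r` need
  -- `s + t ≤ d`; those with a positive power of `y` are indexed by the rest of the cube, making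
  -- exactly `(d + 1) ^ 3`.
  if (i.1 : ℕ) + i.2.1 ≤ d then x ^ (i.1 : ℕ) * ((z - x * y) ^ (i.2.1 : ℕ) * z ^ (i.2.2 : ℕ))
  else y ^ (d + 1 - i.1) * ((z - x * y) ^ (i.2.2 : ℕ) * z ^ (d - i.2.1))

lemma natDegree_basisMonomial_le (d : ℕ) (i : Fin (d + 1) × Fin (d + 1) × Fin (d + 1)) :
    (basisMonomial d i : Tri F).natDegree ≤ d := by
  obtain ⟨s, t, r⟩ := i
  have hr := r.2
  have hw : WeightLE 1 0 0 1 (z - x * y : Tri F) := (WeightLE.z (by simp)).sub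
    ((WeightLE.x (N := 1) le_rfl).mul (WeightLE.y (N := 0) le_rfl))
  rw [← weightLE_x_iff, basisMonomial]
  dsimp only
  split_ifs with h
  · exact (((WeightLE.x le_rfl).pow _).mul ((hw.pow _).mul ((WeightLE.z le_rfl).pow _))).mono
      (by lia)
  · exact (((WeightLE.y le_rfl).pow _).mul ((hw.pow _).mul ((WeightLE.z le_rfl).pow _))).mono
      (by lia)

lemma natDegree_swap_basisMonomial_le (d : ℕ) (i : Fin (d + 1) × Fin (d + 1) × Fin (d + 1)) :
    (swap (basisMonomial d i : Tri F)).natDegree ≤ d := by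
  obtain ⟨s, t, r⟩ := i
  have hr := r.2
  have hw : WeightLE 1 0 0 1 (z - x * y : Tri F) := (WeightLE.z (by simp)).sub
    ((WeightLE.x (N := 1) le_rfl).mul (WeightLE.y (N := 0) le_rfl))
  have h1 : swap (x : Tri F) = y := by simp [swap]
  have h2 : swap (y : Tri F) = -x := by simp [swap]
  have h3 : swap (z : Tri F) = z - x * y := by simp [swap]
  have h4 : swap (z - x * y : Tri F) = z := by rw [map_sub, map_mul, h1, h2, h3]; ring
  rw [← weightLE_x_iff, basisMonomial]
  dsimp only
  split_ifs with h
  · rw [map_mul, map_mul, map_pow, map_pow, map_pow, h1, h3, h4]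
    exact (((WeightLE.y le_rfl).pow _).mul (((WeightLE.z le_rfl).pow _).mul (hw.pow _))).mono
      (by lia)
  · rw [map_mul, map_mul, map_pow, map_pow, map_pow, h2, h3, h4]
    exact (((WeightLE.x le_rfl).neg.pow _).mul (((WeightLE.z le_rfl).pow _).mul (hw.pow _))).mono
      (by lia)

lemma eq_zero_of_sum_basisMonomial {d : ℕ} {c : Fin (d + 1) × Fin (d + 1) × Fin (d + 1) → F}
    (h : ∑ i, c i • (basisMonomial d i : Tri F) = 0) : c = 0 := by
  -- Since `x * y = z - w`, the map `y ↦ (z - w) / x` to Laurent polynomials in `x` over `F[w][z]`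
  -- separates the basis by exponents.
  let f : Tri F →ₐ[F] AddMonoidAlgebra F[X][X] ℤ :=
    subst (.single 1 1) (.single (-1) (X - C X)) (.single 0 X)
  have hw : f (z - x * y) = .single 0 (C X) := by
    simp only [f, map_sub, map_mul, subst_x, subst_y, subst_z, AddMonoidAlgebra.single_mul_single]
    rw [sub_eq_iff_eq_add, add_neg_cancel, ← AddMonoidAlgebra.single_add, one_mul]
    congr 1
    ring
  let n : Fin (d + 1) × Fin (d + 1) × Fin (d + 1) → ℤ := fun i =>
    if (i.1 : ℕ) + i.2.1 ≤ d then (i.1 : ℕ) else -((d + 1 - i.1 : ℕ) : ℤ)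
  let p : Fin (d + 1) × Fin (d + 1) × Fin (d + 1) → ℕ := fun i =>
    if (i.1 : ℕ) + i.2.1 ≤ d then i.2.2 else d - i.2.1
  let q : Fin (d + 1) × Fin (d + 1) × Fin (d + 1) → ℕ := fun i =>
    if (i.1 : ℕ) + i.2.1 ≤ d then i.2.1 else i.2.2
  have hf : ∀ i, f (basisMonomial d i) = .single (n i)
      ((X - C X) ^ (-n i).toNat * (X ^ p i * C X ^ q i)) := by
    rintro ⟨s, t, r⟩
    simp only [basisMonomial, n, p, q]
    split_ifs with hst
    · rw [map_mul, map_mul, map_pow, map_pow, map_pow, hw]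
      simp only [f, subst_x, subst_z, AddMonoidAlgebra.single_pow,
        AddMonoidAlgebra.single_mul_single]
      congr 1
      · simp
      · simp [mul_comm]
    · rw [map_mul, map_mul, map_pow, map_pow, map_pow, hw]
      simp only [f, subst_y, subst_z, AddMonoidAlgebra.single_pow,
        AddMonoidAlgebra.single_mul_single]
      congr 1
      · simp
      · rw [neg_neg, Int.toNat_natCast]
        ring
  funext i₀
  refine eq_zero_of_sum_laurent (n := n) (p := p) (q := q) ?_ ?_ i₀
  · rintro ⟨s, t, r⟩ ⟨s', t', r'⟩ h1 h2 h3
    simp only [n, p, q] at h1 h2 h3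
    simp only [Prod.mk.injEq, Fin.ext_iff]
    have := s.2; have := t.2; have := r.2; have := s'.2; have := t'.2; have := r'.2
    split_ifs at h1 h2 h3 <;> lia
  · have := congrArg f h
    simpa only [map_sum, map_smul, hf, map_zero] using this

/-- A nonzero polynomial of bidegree at most `(d, d)` vanishing at fewer than `(d + 1) ^ 3` given
points. -/
lemma exists_ne_zero_vanishing (d : ℕ) (s : Finset (F × F × F)) (hs : s.card < (d + 1) ^ 3) :
    ∃ E : Tri F, E ≠ 0 ∧ E.natDegree ≤ d ∧ (swap E).natDegree ≤ d ∧
      ∀ v ∈ s, subst v.1 v.2.1 v.2.2 E = 0 := by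
  let L : (Fin (d + 1) × Fin (d + 1) × Fin (d + 1) → F) →ₗ[F] (s → F) :=
    LinearMap.pi fun v => (subst v.1.1 v.1.2.1 v.1.2.2 : Tri F →ₐ[F] F).toLinearMap ∘ₗ
      Fintype.linearCombination F (basisMonomial d)
  have hL : LinearMap.ker L ≠ ⊥ := by
    refine LinearMap.ker_ne_bot_of_finrank_lt ?_
    simp only [Module.finrank_fintype_fun_eq_card, Fintype.card_prod, Fintype.card_fin,
      Fintype.card_coe]
    lia
  obtain ⟨c, hc, hc0⟩ := Submodule.exists_mem_ne_zero_of_ne_bot hL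
  refine ⟨∑ i, c i • basisMonomial d i, fun h0 => hc0 (eq_zero_of_sum_basisMonomial h0), ?_, ?_, ?_⟩
  · exact natDegree_sum_le_of_forall_le _ _ fun i _ =>
      (natDegree_smul_le _ _).trans (natDegree_basisMonomial_le d i)
  · rw [map_sum]
    refine natDegree_sum_le_of_forall_le _ _ fun i _ => ?_
    rw [map_smul]
    exact (natDegree_smul_le _ _).trans (natDegree_swap_basisMonomial_le d i)
  · intro v hv
    have := congrFun (LinearMap.mem_ker.1 hc) ⟨v, hv⟩
    simpa [L, Fintype.linearCombination_apply] using this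

end Tri

/-! ### Global divisibility and decoding. -/

namespace Tri

set_option maxSynthPendingDepth 10

variable {F : Type*} [Field F]

lemma subst_skew (a b c : F) (Φ : Tri F) :
    subst a b (a * b + c) Φ = (line a c (swap Φ)).eval (-b) := by
  rw [eval_line, subst_swap]
  congr 2
  · ring
  · ring

lemma funDegreeLE_xLine {Φ : Tri F} {n : ℕ} (h : Φ.natDegree ≤ n) (b c : F) :
    FunDegreeLE (fun a : F => subst a b c Φ) n :=
  ⟨line b c Φ, (natDegree_line_le b c Φ).trans h, fun a => (eval_line a b c Φ).symm⟩

lemma funDegreeLE_skewLine {Φ : Tri F} {n : ℕ} (h : (swap Φ).natDegree ≤ n) (a c : F) :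
    FunDegreeLE (fun b : F => subst a b (a * b + c) Φ) n := by
  simp only [subst_skew]
  exact FunDegreeLE.comp_neg ⟨line a c (swap Φ), (natDegree_line_le a c _).trans h, fun _ => rfl⟩

lemma isUnit_of_natDegree_eq_zero {Φ : Tri F} (h0 : Φ ≠ 0) (h : Φ.natDegree = 0)
    (hs : (swap Φ).natDegree = 0) : IsUnit Φ := by
  have hw := weightLE_yz h.le hs.le
  have hΦ : Φ = C (C (C (((Φ.coeff 0).coeff 0).coeff 0))) := by
    conv_lhs => rw [eq_C_of_natDegree_eq_zero h]
    rw [C_inj]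
    ext k j
    by_cases hne : ((Φ.coeff 0).coeff k).coeff j = 0
    · rw [hne]
      by_cases hk : k = 0
      · subst hk
        by_cases hj : j = 0
        · subst hj; simp [hne]
        · simp [coeff_C, hj]
      · simp [coeff_C, hk]
    · have := hw 0 j k hne
      obtain rfl : j = 0 := by lia
      obtain rfl : k = 0 := by lia
      simp
  rw [hΦ, isUnit_C, isUnit_C, isUnit_C, isUnit_iff_ne_zero]
  intro hr
  rw [hr] at hΦ
  simp at hΦ
  exact h0 hΦ

lemma isRelPrime_swap {Φ Ψ : Tri F} (h : IsRelPrime Φ Ψ) : IsRelPrime (swap Φ) (swap Ψ) := by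
  intro D h1 h2
  have h3 := h (by simpa only [unswap_swap] using map_dvd unswap h1)
    (by simpa only [unswap_swap] using map_dvd unswap h2)
  simpa only [swap_unswap] using h3.map swap

section Fintype

variable [Fintype F]

/-- Divisibility on all lines of both families implies divisibility. -/
theorem dvd_of_line_dvd {E P : Tri F} (hE : E ≠ 0) {m n d : ℕ} (hEd : E.natDegree ≤ d)
    (hEd' : (swap E).natDegree ≤ d) (hP : P.natDegree ≤ m + E.natDegree)
    (hP' : (swap P).natDegree ≤ n + (swap E).natDegree)
    (hx : ∀ s t, ∃ A : F[X], A.natDegree ≤ m ∧ line s t P = line s t E * A)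
    (hy : ∀ s t, ∃ A : F[X], A.natDegree ≤ n ∧ line s t (swap P) = line s t (swap E) * A)
    (hq : 2 * m + n + 3 * d < Fintype.card F) (hq' : m + 2 * n + 3 * d < Fintype.card F) :
    E ∣ P := by
  by_cases hP0 : P = 0
  · rw [hP0]; exact dvd_zero E
  obtain ⟨E', P', G, hrel, rfl, rfl⟩ := UniqueFactorizationMonoid.exists_reduced_factors E hE P
  have hG0 := left_ne_zero_of_mul hE
  have hE0 := right_ne_zero_of_mul hE
  have hP0' := right_ne_zero_of_mul hP0
  simp only [map_mul] at hEd' hP' hx hy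
  rw [natDegree_mul hG0 hE0] at hEd hP
  rw [natDegree_mul hG0 hP0'] at hP
  rw [natDegree_mul (swap_ne_zero hG0) (swap_ne_zero hE0)] at hEd' hP'
  rw [natDegree_mul (swap_ne_zero hG0) (swap_ne_zero hP0')] at hP'
  have hss := natDegree_swap_swap_le E'
  have hsP := natDegree_swap_swap_le P'
  have hsG := natDegree_swap_swap_le G
  have hunit : IsUnit E' := by
    -- The intersection count applies to the family in which `E'` has the larger degree; the other
    -- degree is then zero as well.
    rcases le_total (swap E').natDegree E'.natDegree with hle | hle
    · have h0 : E'.natDegree = 0 := by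
        refine natDegree_eq_zero_of_line_dvd (n := m + E'.natDegree) (b := n + (swap E').natDegree)
          hG0 hrel (by lia) (by lia) (fun s t => ?_) hle (by lia)
        obtain ⟨A, hA, h⟩ := hx s t
        exact ⟨A, by lia, by simpa only [map_mul] using h⟩
      exact isUnit_of_natDegree_eq_zero hE0 h0 (by lia)
    · have h0 : (swap E').natDegree = 0 := by
        refine natDegree_eq_zero_of_line_dvd (n := n + (swap E').natDegree)
          (b := m + E'.natDegree) (swap_ne_zero hG0) (isRelPrime_swap hrel) (by lia) (by lia)
          (fun s t => ?_) (by lia) (by lia)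
        obtain ⟨A, hA, h⟩ := hy s t
        exact ⟨A, by lia, by simpa only [map_mul] using h⟩
      exact isUnit_of_natDegree_eq_zero hE0 (by lia) h0
  exact mul_dvd_mul_left G hunit.dvd

/-- A nonzero polynomial of bidegree `(m, n)` vanishes identically on few `x`-lines. -/
lemma card_line_eq_zero_le {E : Tri F} (hE : E ≠ 0) {m n : ℕ} (hm : E.natDegree ≤ m)
    (hn : (swap E).natDegree ≤ n) {s : Finset (F × F)} (hs : ∀ v ∈ s, line v.1 v.2 E = 0) :
    s.card ≤ (m + n) * Fintype.card F := by
  classical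
  set g := E.leadingCoeff with hg
  have hg0 : g ≠ 0 := leadingCoeff_ne_zero.2 hE
  set l := g.leadingCoeff with hl
  have hl0 : l ≠ 0 := leadingCoeff_ne_zero.2 hg0
  have hdeg : l.natDegree + g.natDegree ≤ m + n := by
    have := weightLE_yz hm hn E.natDegree l.natDegree g.natDegree (leadingCoeff_ne_zero.2 hl0)
    lia
  -- Schwartz–Zippel for the leading coefficient `g` of `E`: either `b` is a root of its leading
  -- coefficient `l`, or `c` is a root of the nonzero polynomial `g (b, ·)`.
  have hsub : s ⊆ l.roots.toFinset ×ˢ Finset.univ ∪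
      Finset.univ.biUnion fun b => {b} ×ˢ
        (if l.eval b = 0 then ∅ else (g.map (evalRingHom b)).roots.toFinset) := by
    rintro ⟨b, c⟩ hv
    have h1 : g.evalEval b c = 0 := by
      rw [hg, leadingCoeff, ← coeff_line, hs _ hv, coeff_zero]
    by_cases hb : l.eval b = 0
    · simp [hl0, hb]
    · refine Finset.mem_union_right _ (Finset.mem_biUnion.2 ⟨b, Finset.mem_univ b, ?_⟩)
      have h2 : g.map (evalRingHom b) ≠ 0 := by
        intro h0
        apply hb
        simpa using congrArg (fun P => P.coeff g.natDegree) h0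
      simp only [Finset.mem_product, Finset.mem_singleton, true_and, if_neg hb]
      rw [Multiset.mem_toFinset, mem_roots h2, IsRoot.def, map_evalRingHom_eval]
      exact h1
  refine (Finset.card_le_card hsub).trans ((Finset.card_union_le _ _).trans ?_)
  have h1 : (l.roots.toFinset ×ˢ (Finset.univ : Finset F)).card ≤
      l.natDegree * Fintype.card F := by
    rw [Finset.card_product, Finset.card_univ]
    exact Nat.mul_le_mul_right _ ((Multiset.toFinset_card_le _).trans (card_roots' l))
  have h2 : (Finset.univ.biUnion fun b : F => {b} ×ˢ
      (if l.eval b = 0 then ∅ else (g.map (evalRingHom b)).roots.toFinset)).card ≤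
      Fintype.card F * g.natDegree := by
    refine Finset.card_biUnion_le_card_mul _ _ _ fun b _ => ?_
    rw [Finset.card_product, Finset.card_singleton, one_mul]
    split_ifs
    · simp
    · exact (Multiset.toFinset_card_le _).trans ((card_roots' _).trans natDegree_map_le)
  calc _ ≤ l.natDegree * Fintype.card F + Fintype.card F * g.natDegree := add_le_add h1 h2
    _ = (l.natDegree + g.natDegree) * Fintype.card F := by ring
    _ ≤ _ := Nat.mul_le_mul_right _ hdeg

/-- If `E` vanishes where `X` and `Y` differ, then there is a codeword `Q` that agrees with `X` and
with `Y` on every line on which `E` does not vanish identically. -/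
theorem exists_codeword {E : Tri F} (hE : E ≠ 0) {dx dy d : ℕ} (hd : 1 ≤ d)
    (hEd : E.natDegree ≤ d) (hEd' : (swap E).natDegree ≤ d)
    (hchar : ∀ k : ℕ, 0 < k → k < Fintype.card F → (k : F) ≠ 0)
    (hq : 2 * (dx + dy) + 5 * d ≤ Fintype.card F) {X Y : F × F × F → F}
    (hX : ∀ b c, FunDegreeLE (xLine X b c) dx) (hY : ∀ a c, FunDegreeLE (skewLine Y a c) dy)
    (hvan : ∀ a b c, X (a, b, c) ≠ Y (a, b, c) → subst a b c E = 0) :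
    ∃ Q ∈ localCode F dx dy, (∀ b c, line b c E ≠ 0 → xLine X b c = xLine Q b c) ∧
      ∀ a c, line a c (swap E) ≠ 0 → skewLine Y a c = skewLine Q a c := by
  have hXY : ∀ a b c, subst a b c E * X (a, b, c) = subst a b c E * Y (a, b, c) := fun a b c => by
    by_cases h : X (a, b, c) = Y (a, b, c)
    · rw [h]
    · rw [hvan a b c h, zero_mul, zero_mul]
  -- The numerical side conditions here and for the divisibility below follow from `hq` because `d ≥
  -- 1`.
  obtain ⟨P, hPx, hPy, hP⟩ := exists_of_mem_localCode (F := F) (m := dx + E.natDegree)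
    (n := dy + (swap E).natDegree) (by lia) (by lia) hchar
    (f := fun v => subst v.1 v.2.1 v.2.2 E * X v) ⟨fun b c => by
      rw [add_comm dx]
      exact (funDegreeLE_xLine le_rfl b c).mul (hX b c), fun a c => by
      rw [add_comm dy]
      simp only [hXY]
      exact (funDegreeLE_skewLine le_rfl a c).mul (hY a c)⟩
  have hx : ∀ b c, ∃ A : F[X], A.natDegree ≤ dx ∧ line b c P = line b c E * A ∧
      ∀ a, X (a, b, c) = A.eval a := by
    intro b c
    obtain ⟨A, hA, hXA⟩ := hX b c
    refine ⟨A, hA, eq_of_eval_eq ?_ ?_ fun a => ?_, hXA⟩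
    · have := natDegree_line_le b c P
      lia
    · have h1 := natDegree_line_le b c E
      have h2 : (line b c E * A).natDegree ≤ _ := natDegree_mul_le
      lia
    · rw [eval_mul, eval_line, eval_line, hP, ← hXA a]
      rfl
  have hy : ∀ a c, ∃ A : F[X], A.natDegree ≤ dy ∧ line a c (swap P) = line a c (swap E) * A ∧
      ∀ b, Y (a, b, a * b + c) = A.eval (-b) := by
    intro a c
    obtain ⟨A, hA, hYA⟩ := (hY a c).comp_neg
    refine ⟨A, hA, eq_of_eval_eq ?_ ?_ fun t => ?_, fun b => by
      rw [← hYA]; simp [skewLine]⟩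
    · have := natDegree_line_le a c (swap P)
      lia
    · have h1 := natDegree_line_le a c (swap E)
      have h2 : (line a c (swap E) * A).natDegree ≤ _ := natDegree_mul_le
      lia
    · have h1 := subst_skew a (-t) c P
      have h2 := subst_skew a (-t) c E
      rw [neg_neg] at h1 h2
      rw [eval_mul, ← h1, ← h2, hP, ← hYA t]
      exact hXY _ _ _
  obtain ⟨Q, rfl⟩ : E ∣ P := by
    refine dvd_of_line_dvd hE (m := dx) (n := dy) hEd hEd' hPx hPy (fun s t => ?_) (fun s t => ?_)
      (by lia) (by lia)
    · obtain ⟨A, h1, h2, -⟩ := hx s t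
      exact ⟨A, h1, h2⟩
    · obtain ⟨A, h1, h2, -⟩ := hy s t
      exact ⟨A, h1, h2⟩
  have hQx : Q.natDegree ≤ dx := by
    by_cases hQ : Q = 0
    · simp [hQ]
    · rw [natDegree_mul hE hQ] at hPx
      lia
  have hQy : (swap Q).natDegree ≤ dy := by
    by_cases hQ : Q = 0
    · simp [hQ]
    · rw [map_mul, natDegree_mul (swap_ne_zero hE) (swap_ne_zero hQ)] at hPy
      lia
  refine ⟨fun v => subst v.1 v.2.1 v.2.2 Q, ⟨funDegreeLE_xLine hQx, funDegreeLE_skewLine hQy⟩,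
    fun b c h => ?_, fun a c h => ?_⟩
  · obtain ⟨A, -, h1, h2⟩ := hx b c
    rw [map_mul] at h1
    funext a
    simp only [xLine]
    rw [h2, ← mul_left_cancel₀ h h1, eval_line]
  · obtain ⟨A, -, h1, h2⟩ := hy a c
    rw [map_mul, map_mul] at h1
    funext b
    simp only [skewLine]
    rw [h2, ← mul_left_cancel₀ h h1, subst_skew]

end Fintype

end Tri

/-! ### From counting lines to probabilities. -/

lemma uniformProb_le_of_card_le {p N : ℕ} [Fact p.Prime] {A : ZMod p × ZMod p → Prop}
    (h : ∀ s : Finset (ZMod p × ZMod p), (∀ v ∈ s, A v) → s.card ≤ N * p) :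
    uniformProb A ≤ N / p := by
  classical
  have hp : (0 : ℝ) < p := Nat.cast_pos.2 (Fact.out : p.Prime).pos
  have h1 : ((Finset.univ.filter A).card : ℝ) ≤ N * p := by
    exact_mod_cast h _ fun v hv => (Finset.mem_filter.1 hv).2
  rw [uniformProb, Fintype.card_prod, ZMod.card, Nat.cast_mul,
    div_le_div_iff₀ (mul_pos hp hp) hp]
  calc _ ≤ (N * p : ℝ) * p := by
        gcongr
    _ = _ := by ring

theorem mainTheorem4 (p : ℕ) [Fact p.Prime] (dx dy : ℕ)
    (X Y : ZMod p × ZMod p × ZMod p → ZMod p)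
    (hX : ∀ b c : ZMod p, FunDegreeLE (xLine X b c) dx)
    (hY : ∀ a c : ZMod p, FunDegreeLE (skewLine Y a c) dy)
    (δ : ℝ)
    (hδ : uniformProb (fun v : ZMod p × ZMod p × ZMod p => X v ≠ Y v) = δ ^ 3)
    (hp : (p : ℝ) ≥ 2 * ((dx : ℝ) + (dy : ℝ)) + 5 * δ * (p : ℝ)) :
    ∃ Q ∈ localCode (ZMod p) dx dy,
      uniformProb (fun bc : ZMod p × ZMod p => xLine X bc.1 bc.2 ≠ xLine Q bc.1 bc.2) +
        uniformProb (fun ac : ZMod p × ZMod p => skewLine Y ac.1 ac.2 ≠ skewLine Q ac.1 ac.2)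
        ≤ 4 * δ := by
  classical
  have hp0 : (0 : ℝ) < p := Nat.cast_pos.2 (Fact.out : p.Prime).pos
  set s : Finset (ZMod p × ZMod p × ZMod p) := Finset.univ.filter fun v => X v ≠ Y v with hs
  have hcard : (s.card : ℝ) = (δ * p) ^ 3 := by
    have h1 : uniformProb (fun v : ZMod p × ZMod p × ZMod p => X v ≠ Y v) =
        (s.card : ℝ) / (p * (p * p) : ℝ) := by
      rw [uniformProb, Fintype.card_prod, Fintype.card_prod, ZMod.card]
      push_cast
      congr!
    rw [h1, div_eq_iff (by positivity)] at hδ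
    rw [hδ]
    ring
  have hδp : 0 ≤ δ * p := by
    by_contra! h
    have h1 : (δ * p) ^ 3 < 0 := Odd.pow_neg (by decide) h
    rw [← hcard] at h1
    exact absurd h1 (not_lt.2 (Nat.cast_nonneg _))
  have hδ0 : 0 ≤ δ := nonneg_of_mul_nonneg_left hδp hp0
  set d := ⌊δ * p⌋₊ with hd
  have hd1 : (d : ℝ) ≤ δ * p := Nat.floor_le hδp
  have hd2 : δ * p < d + 1 := Nat.lt_floor_add_one _
  have hscard : s.card < (d + 1) ^ 3 := by
    have : (s.card : ℝ) < ((d + 1 : ℕ) : ℝ) ^ 3 := by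
      rw [hcard]
      push_cast
      gcongr
    exact_mod_cast this
  -- For `d = 0` there are no errors, so `X = Y` is itself a codeword; this case has no slack for
  -- the strict degree inequalities.
  rcases Nat.eq_zero_or_pos d with hd0 | hdpos
  · have hs0 : s = ∅ := by
      rw [hd0] at hscard
      exact Finset.card_eq_zero.1 (by lia)
    have hXY : X = Y := by
      funext v
      by_contra hne
      have : v ∈ s := Finset.mem_filter.2 ⟨Finset.mem_univ v, hne⟩
      simp [hs0] at this
    refine ⟨X, ⟨hX, hXY ▸ hY⟩, ?_⟩
    simp only [hXY, ne_eq, not_true_eq_false, uniformProb, Finset.filter_false, Finset.card_empty,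
      Nat.cast_zero, zero_div, add_zero]
    positivity
  · obtain ⟨E, hE, hEd, hEd', hEs⟩ := Tri.exists_ne_zero_vanishing d s hscard
    have hq : 2 * (dx + dy) + 5 * d ≤ Fintype.card (ZMod p) := by
      rw [ZMod.card]
      have : (2 * (dx + dy) + 5 * d : ℝ) ≤ p := by linarith
      exact_mod_cast this
    obtain ⟨Q, hQ, hQx, hQy⟩ := Tri.exists_codeword hE hdpos hEd hEd' (fun k hk hkp => by
        rw [ZMod.card] at hkp
        rw [Ne, ZMod.natCast_eq_zero_iff]
        exact Nat.not_dvd_of_pos_of_lt hk hkp) hq hX hY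
      (fun a b c h => hEs _ (Finset.mem_filter.2 ⟨Finset.mem_univ _, h⟩))
    have h1 : uniformProb (fun bc : ZMod p × ZMod p => xLine X bc.1 bc.2 ≠ xLine Q bc.1 bc.2) ≤
        (d + d : ℕ) / p := uniformProb_le_of_card_le fun t ht => by
      have := Tri.card_line_eq_zero_le hE hEd hEd' (s := t) fun v hv => by
        by_contra h
        exact ht v hv (hQx _ _ h)
      rwa [ZMod.card] at this
    have h2 : uniformProb (fun ac : ZMod p × ZMod p =>
        skewLine Y ac.1 ac.2 ≠ skewLine Q ac.1 ac.2) ≤ (d + d : ℕ) / p :=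
      uniformProb_le_of_card_le fun t ht => by
      have := Tri.card_line_eq_zero_le (Tri.swap_ne_zero hE) hEd'
        ((Tri.natDegree_swap_swap_le E).trans hEd) (s := t) fun v hv => by
          by_contra h
          exact ht v hv (hQy _ _ h)
      rwa [ZMod.card] at this
    have h3 : ((d + d : ℕ) : ℝ) / p ≤ 2 * δ := by
      rw [div_le_iff₀ hp0]
      push_cast
      linarith
    exact ⟨Q, hQ, by linarith⟩
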